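/- Let $m,n\ge 1$, let $R$ be a commutative ring, and let $A\in M_{mn,m}(R)$, $B\in M_{mn,n}(R)$ have rows $\underline a_r$, $\underline b_r$ ($1\le r\le mn$). Let $A\star B$ be the $mn\times mn$ matrix whose $r$-th row is the Kronecker product $\underline a_r\otimes\underline b_r=(a_{r1}b_{r1},a_{r2}b_{r1},\dots,a_{rm}b_{r1},\,a_{r1}b_{r2},\dots,a_{rm}b_{r2},\dots,a_{rm}b_{rn})$. Let $\lambda=n^m$ be the rectangle with $m$ rows and $n$ columns, and $\lambda'=m^n$ its conjugate. A tableau is a filling of the boxes by $1,\dots,mn$, each used once; it is standard if rows and columns are increasing; $\gamma'$ denotes the conjugate (reflected) tableau. Let $1_\lambda$ be the tableau of shape $\lambda$ filled consecutively from top to bottom, then left to right. For a tableau $\gamma$ of shape $\lambda$ let $\varepsilon(\gamma)$ be the sign of the permutation $\pi$ with $\pi(1_\lambda)=\gamma$; for a tableau $\beta$ of shape $\lambda'$ put $\varepsilon(\beta)=\varepsilon(\beta')$, i.e. the sign of the permutation taking the conjugate $(1_\lambda)'$ to $\beta$. For standard tableaux $\alpha$ of shape $\lambda$ and $\beta$ of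 shape $\lambda'$ let $\langle\alpha,\beta\rangle=0$ if two distinct numbers lie in a common column of $\alpha$ and in a common column of $\beta$; otherwise let $\langle\alpha,\beta\rangle=\varepsilon(\gamma)$, where $\gamma$ is the unique tableau of shape $\lambda$ such that $\gamma$ and $\alpha$ have the same set of entries in each column, and so do $\gamma'$ and $\beta$. Let $G$ be the integer matrix with entries $G_{\alpha,\beta}=\varepsilon(\alpha)\,\langle\alpha,\beta\rangle\,\varepsilon(\beta)$, the rows being indexed by the standard tableaux $\alpha$ of shape $\lambda$ and the columns by the standard tableaux $\beta$ of shape $\lambda'$. For a set $I$ of $m$ (resp. $n$) row indices let $A_I$ (resp. $B_I$) be the square matrix formed by the rows of $A$ (resp. $B$) indexed by $I$ in increasing order, and put $A_\alpha=\prod_{i=1}^n\det A_{\mathrm{col}_i(\alpha)}$ and $B_\beta=\prod_{j=1}^m\det B_{\mathrm{col}_j(\beta)}$, where $\mathrm{col}_i$ denotes the set of entries of the $i$-th column. Then $G$ is invertible over $\mathbb Z$, and with $\Phi=(G^{-1})^{T}$ one has $$\det(A\star B)=\sum_{\alpha,\beta}\Phi_{\alpha,\beta}\,A_\alpha B_\beta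 ,$$ the sum being over all standard tableaux $\alpha$ of shape $n^m$ and $\beta$ of shape $m^n$. -/

import Mathlib

open scoped Matrix

/-- A (not necessarily standard) tableau of rectangular shape `n^m`: a bijective filling of the
boxes of the rectangle with `m` rows and `n` columns by the numbers `0, …, N - 1`
(so necessarily `N = m * n`). The box in row `i` and column `j` is `(i, j)`. -/
abbrev RectTableau (m n N : ℕ) : Type := Fin m × Fin n ≃ Fin N

namespace RectTableau

variable {m n N : ℕ}

/-- Entries increase along every row (left to right) and down every column. -/
def IsStandard (γ : RectTableau m n N) : Prop :=
  (∀ i, StrictMono fun j => γ (i, j)) ∧ (∀ j, StrictMono fun i => γ (i, j))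

/-- The conjugate tableau `γ'`, of shape `m^n`, obtained by reflection in the diagonal. -/
def conj (γ : RectTableau m n N) : RectTableau n m N := (Equiv.prodComm (Fin n) (Fin m)).trans γ

theorem conj_apply (γ : RectTableau m n N) (i : Fin n) (j : Fin m) : γ.conj (i, j) = γ (j, i) := rfl

theorem IsStandard.conj {γ : RectTableau m n N} (h : γ.IsStandard) :
    (RectTableau.conj γ).IsStandard := ⟨h.2, h.1⟩

/-- The set of numbers in the `j`-th column. -/
def col (γ : RectTableau m n N) (j : Fin n) : Finset (Fin N) :=
  Finset.univ.image fun i => γ (i, j)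

theorem card_col (γ : RectTableau m n N) (j : Fin n) : (γ.col j).card = m := by
  unfold col
  rw [Finset.card_image_of_injective, Finset.card_univ, Fintype.card_fin]
  intro a b h
  simpa using h

theorem mem_col (γ : RectTableau m n N) (j : Fin n) (x : Fin N) :
    x ∈ γ.col j ↔ (γ.symm x).2 = j := by
  simp only [col, Finset.mem_image, Finset.mem_univ, true_and]
  constructor
  · rintro ⟨i, rfl⟩
    simp
  · rintro rfl
    exact ⟨(γ.symm x).1, by simp⟩

/-- Two tableaux are column-equivalent if they differ only by permuting the elements of each
column, i.e. if corresponding columns contain the same numbers. -/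
def ColEquiv (γ δ : RectTableau m n N) : Prop := ∀ j, γ.col j = δ.col j

/-- The tableau `1_λ`, `λ = n^m`, filled consecutively from top to bottom, then left to right:
its `(i, j)` entry is `i + m * j`. -/
def one (m n : ℕ) : RectTableau m n (m * n) :=
  (Equiv.prodComm (Fin m) (Fin n)).trans (finProdFinEquiv.trans (finCongr (Nat.mul_comm n m)))

theorem one_val (m n : ℕ) (i : Fin m) (j : Fin n) : (one m n (i, j) : ℕ) = i + m * j := by
  simp [one]

/-- The sign `ε(γ)` of the permutation `π` of the numbers with `π(1_λ) = γ`, for a tableau `γ`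
of shape `λ = n^m`. -/
def sign (γ : RectTableau m n (m * n)) : ℤ :=
  (Equiv.Perm.sign ((one m n).symm.trans γ) : ℤ)

/-- Two distinct numbers lie in a common column of `α` and in a common column of `β`. -/
def HasCommonPair (α : RectTableau m n N) (β : RectTableau n m N) : Prop :=
  ∃ x y : Fin N, x ≠ y ∧ (∃ j, x ∈ α.col j ∧ y ∈ α.col j) ∧ (∃ k, x ∈ β.col k ∧ y ∈ β.col k)

theorem existsUnique_of_not_hasCommonPair {α : RectTableau m n N} {β : RectTableau n m N}
    (h : ¬ HasCommonPair α β) :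
    ∃! γ : RectTableau m n N, γ.ColEquiv α ∧ γ.conj.ColEquiv β := by
  have key : ∀ γ : RectTableau m n N, (γ.ColEquiv α ∧ γ.conj.ColEquiv β) ↔
      ∀ x, γ.symm x = ((β.symm x).2, (α.symm x).2) := by
    intro γ
    have hc : ∀ x, (γ.conj.symm x).2 = (γ.symm x).1 := fun x => rfl
    simp only [ColEquiv, Finset.ext_iff, mem_col, hc]
    constructor
    · rintro ⟨h1, h2⟩ x
      exact Prod.ext ((h2 _ x).2 rfl) ((h1 _ x).2 rfl)
    · intro h
      exact ⟨fun j x => by rw [h x], fun j x => by rw [h x]⟩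
  simp only [key]
  have inj : Function.Injective fun x : Fin N => ((β.symm x).2, (α.symm x).2) := by
    intro x y hxy
    by_contra hne
    simp only [Prod.mk.injEq] at hxy
    exact h ⟨x, y, hne, ⟨(α.symm y).2, by simp [mem_col, hxy.2], by simp [mem_col]⟩,
      ⟨(β.symm y).2, by simp [mem_col, hxy.1], by simp [mem_col]⟩⟩
  have bij : Function.Bijective fun x : Fin N => ((β.symm x).2, (α.symm x).2) :=
    (Fintype.bijective_iff_injective_and_card _).2 ⟨inj, (Fintype.card_congr α).symm⟩
  refine ⟨(Equiv.ofBijective _ bij).symm, fun x => rfl, fun γ hγ => ?_⟩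
  apply Equiv.symm_bijective.injective
  ext1 x
  rw [hγ x]
  rfl

open Classical in
/-- The Fayers number `⟨α, β⟩`: zero if two distinct numbers lie in a common column of `α` and a
common column of `β`; otherwise the sign of the unique tableau `γ` that is column-equivalent to
`α` and whose conjugate is column-equivalent to `β`. -/
noncomputable def fayersNumber (α : RectTableau m n (m * n)) (β : RectTableau n m (m * n)) : ℤ :=
  if h : HasCommonPair α β then 0
  else sign (existsUnique_of_not_hasCommonPair h).choose

end RectTableau

/-- Standard Young tableaux of shape `n^m` (`m` rows of length `n`). -/
abbrev StdRectTableau (m n N : ℕ) : Type := {γ : RectTableau m n N // γ.IsStandard}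

namespace StdRectTableau

noncomputable instance (m n N : ℕ) : Fintype (StdRectTableau m n N) := Fintype.ofFinite _

/-- Conjugation `α ↦ α'` as a bijection between standard tableaux of conjugate shapes. -/
def conjEquiv (m n N : ℕ) : StdRectTableau m n N ≃ StdRectTableau n m N where
  toFun α := ⟨α.1.conj, α.2.conj⟩
  invFun β := ⟨β.1.conj, β.2.conj⟩
  left_inv _ := rfl
  right_inv _ := rfl

end StdRectTableau

/-- The Fayers matrix `F`. -/
noncomputable def fayersMatrix (m n : ℕ) :
    Matrix (StdRectTableau m n (m * n)) (StdRectTableau n m (m * n)) ℤ :=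
  Matrix.of fun α β => RectTableau.fayersNumber α.1 β.1

/-- The sign-twisted Fayers matrix `ℰ F ℰ`, with entries `ε(α) ⟨α, β⟩ ε(β)`. Here `λ = n^m` is
fixed, and the sign of a tableau `β` of the conjugate shape is taken relative to the conjugate
`(1_λ)'` of the reference tableau; equivalently, it is the sign of `β'`. -/
noncomputable def twistedFayersMatrix (m n : ℕ) :
    Matrix (StdRectTableau m n (m * n)) (StdRectTableau n m (m * n)) ℤ :=
  Matrix.of fun α β => α.1.sign * fayersMatrix m n α β * β.1.conj.sign

/-- The matrix `Φ`, the inverse transpose of `ℰ F ℰ`. Mathlib's matrix inverse needs rows and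
columns indexed by the same type, so the columns are identified with the rows through
`β = α'` before inverting, and the identification is undone afterwards. -/
noncomputable def fayersPhi (m n : ℕ) :
    Matrix (StdRectTableau m n (m * n)) (StdRectTableau n m (m * n)) ℤ :=
  (((twistedFayersMatrix m n).submatrix id (StdRectTableau.conjEquiv m n (m * n)))⁻¹)ᵀ.submatrix
    id (StdRectTableau.conjEquiv m n (m * n)).symm

/-- The amalgam `A ⋆ B`, whose `r`-th row is the Kronecker product of the `r`-th rows of `A` and
`B`, ordered as `(a₁b₁, a₂b₁, …, aₘb₁, a₁b₂, …, aₘbₙ)`: the entry `a_k b_l` (`k`, `l` counted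
from `0`) stands in column `k + m * l`. -/
def amalgam {R : Type*} [CommRing R] {m n : ℕ} (A : Matrix (Fin (m * n)) (Fin m) R)
    (B : Matrix (Fin (m * n)) (Fin n) R) : Matrix (Fin (m * n)) (Fin (m * n)) R :=
  Matrix.of fun r c =>
    A r ((RectTableau.one m n).symm c).1 * B r ((RectTableau.one m n).symm c).2

/-- The square matrix `A_I` formed by the rows of `A` indexed by `I`, in increasing order. -/
def rowMinor {R : Type*} {m N : ℕ} (A : Matrix (Fin N) (Fin m) R) (I : Finset (Fin N))
    (hI : I.card = m) : Matrix (Fin m) (Fin m) R :=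
  A.submatrix (I.orderEmbOfFin hI) id

/-- `A_α = ∏ⱼ det A_{colⱼ(α)}`, the product over the columns of `α`. -/
def minorProd {R : Type*} [CommRing R] {m n N : ℕ} (A : Matrix (Fin N) (Fin m) R)
    (α : RectTableau m n N) : R :=
  ∏ j : Fin n, (rowMinor A (α.col j) (α.card_col j)).det

/-!
Write `D(w, v)` for the coefficient of `∏ r, a_{r, w r} b_{r, v r}` in `det (A ⋆ B)`, where `w` and
`v` are words in the column indices of `A` and `B`. It is the determinant of the amalgam of two 0-1
matrices, is nonzero only if `(w, v)` records the rows and columns of a tableau `γ`, and is then the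
sign of `γ`. In particular the Fayers number `⟨α, β⟩` is `D(w, v)` for the words `w`, `v` recording
the columns of `β` and of `α` (`fayersNumber_eq_wordDet`). When `v` records the columns
of `α`, the matrix `A ⋆ B` is block diagonal up to a permutation of its rows, so `A_α` is up to sign
such a specialization of `det (A ⋆ B)`, and likewise `B_β` (`colDetProd_eq_sign_mul_left`,
`colDetProd_eq_sign_mul_right`).

The theorem thus says that the matrix `D`, indexed by all words, equals `D_{•,S} F⁻¹ D_{S,•}`, where
`S` stands for the standard tableaux and `F = D_{S,S}`. Such an identity holds as soon as `F` is
invertible and the rows of `D` are spanned by those in `S`.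

* `F` is unimodular (`isUnit_det_twistedFayersMatrix`): with columns identified with rows through
  `β = α'` it is triangular with signs on the diagonal, by the rearrangement inequality
  (`wordWeight_le_of_wordDet_ne_zero`).
* The rows in `S` span the row space over `ℚ` (`wordDet_rowWord_mem_span`), by Garnir relations
  (`sum_wordDet_comp_perm_eq_zero`) and induction on the weight of a word. Since the resulting
  identity involves only integers (`wordDet_eq_sum`), rational straightening coefficients suffice.

Both sides of the expansion are multilinear in the rows of `A` and of `B`, so it follows over every
commutative ring from the case of word matrices.
-/

/-! ### Words, and the amalgam of a matrix with a word matrix -/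

/-- The matrix of the word `w`: its `r`-th row is the standard basis vector `e_{w r}`. -/
def wordMatrix (R : Type*) [CommRing R] {m N : ℕ} (w : Fin N → Fin m) : Matrix (Fin N) (Fin m) R :=
  (1 : Matrix (Fin m) (Fin m) R).submatrix w id

theorem wordMatrix_apply (R : Type*) [CommRing R] {m N : ℕ} (w : Fin N → Fin m) (r : Fin N)
    (k : Fin m) : wordMatrix R w r k = if w r = k then 1 else 0 :=
  Matrix.one_apply

namespace RectTableau

variable {m n N : ℕ}

/-- The word recording in which row of the tableau each number stands. -/
def rowWord (γ : RectTableau m n N) (r : Fin N) : Fin m := (γ.symm r).1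

/-- The word recording in which column of the tableau each number stands. -/
def colWord (γ : RectTableau m n N) (r : Fin N) : Fin n := (γ.symm r).2

theorem sign_mul_self (γ : RectTableau m n (m * n)) : γ.sign * γ.sign = 1 := by
  unfold sign
  rw [← Units.val_mul, Int.units_mul_self, Units.val_one]

theorem isUnit_sign (γ : RectTableau m n (m * n)) : IsUnit γ.sign :=
  IsUnit.of_mul_eq_one _ γ.sign_mul_self

/-- A pair of words in which no pair of letters occurs twice consists of the row word and the
column word of a tableau. -/
theorem exists_of_injective {w : Fin (m * n) → Fin m} {v : Fin (m * n) → Fin n}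
    (h : Function.Injective fun r => (w r, v r)) :
    ∃ γ : RectTableau m n (m * n), γ.rowWord = w ∧ γ.colWord = v :=
  have bij := (Fintype.bijective_iff_injective_and_card _).2 ⟨h, by simp⟩
  ⟨(Equiv.ofBijective _ bij).symm, rfl, rfl⟩

end RectTableau

open RectTableau

/-- The product over the columns of `γ` of the minors of `A` formed by the rows of `A` in the order
in which their indices stand in that column. -/
def colDetProd {R : Type*} [CommRing R] {m n N : ℕ} (A : Matrix (Fin N) (Fin m) R)
    (γ : RectTableau m n N) : R :=
  ∏ j : Fin n, (A.submatrix (fun i => γ (i, j)) id).det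

theorem minorProd_eq_colDetProd {R : Type*} [CommRing R] {m n N : ℕ} (A : Matrix (Fin N) (Fin m) R)
    {γ : RectTableau m n N} (h : γ.IsStandard) : minorProd A γ = colDetProd A γ := by
  unfold minorProd colDetProd rowMinor
  refine Finset.prod_congr rfl fun j _ => ?_
  rw [Finset.orderEmbOfFin_unique (γ.card_col j) (f := fun i => γ (i, j)) _ (h.2 j)]
  intro i
  simp [mem_col]

section

variable {R : Type*} [CommRing R] {m n : ℕ}

theorem sign_mul_det_amalgam (γ : RectTableau m n (m * n)) (A : Matrix (Fin (m * n)) (Fin m) R)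
    (B : Matrix (Fin (m * n)) (Fin n) R) :
    (γ.sign : R) * (amalgam A B).det =
      (Matrix.of fun (x y : Fin m × Fin n) => A (γ x) y.1 * B (γ x) y.2).det := by
  unfold RectTableau.sign
  rw [← Matrix.det_permute, ← Matrix.det_submatrix_equiv_self (one m n)]
  congr 1
  ext x y
  simp [amalgam]

/-- When `B` is the matrix of the column word of `γ`, listing the rows in the order given by `γ`
makes `A ⋆ B` block diagonal. -/
theorem colDetProd_eq_sign_mul_left (γ : RectTableau m n (m * n))
    (A : Matrix (Fin (m * n)) (Fin m) R) :
    colDetProd A γ = γ.sign * (amalgam A (wordMatrix R γ.colWord)).det := by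
  rw [sign_mul_det_amalgam, colDetProd, ← Matrix.det_blockDiagonal]
  congr 1
  ext x y
  simp [wordMatrix_apply, colWord, Matrix.blockDiagonal_apply]

theorem colDetProd_eq_sign_mul_right (γ : RectTableau n m (m * n))
    (B : Matrix (Fin (m * n)) (Fin n) R) :
    colDetProd B γ = γ.conj.sign * (amalgam (wordMatrix R γ.colWord) B).det := by
  rw [sign_mul_det_amalgam, colDetProd, ← Matrix.det_blockDiagonal,
    ← Matrix.det_submatrix_equiv_self (Equiv.prodComm (Fin n) (Fin m))]
  congr 1
  ext x y
  simp [wordMatrix_apply, colWord, Matrix.blockDiagonal_apply, conj_apply, Prod.swap]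

end

/-- The coefficient of `∏ r, a_{r, w r} b_{r, v r}` in `det (A ⋆ B)`, obtained by specializing `A`
and `B` to the matrices of the words `w` and `v`. -/
def wordDet {m n : ℕ} (w : Fin (m * n) → Fin m) (v : Fin (m * n) → Fin n) : ℤ :=
  (amalgam (wordMatrix ℤ w) (wordMatrix ℤ v)).det

theorem det_amalgam_wordMatrix (R : Type*) [CommRing R] {m n : ℕ} (w : Fin (m * n) → Fin m)
    (v : Fin (m * n) → Fin n) :
    (amalgam (wordMatrix R w) (wordMatrix R v)).det = (wordDet w v : R) := by
  rw [wordDet, ← eq_intCast (Int.castRingHom R), RingHom.map_det]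
  congr 1
  ext x y
  simp [amalgam, wordMatrix_apply]

section

variable {m n : ℕ}

theorem wordDet_eq_zero {w : Fin (m * n) → Fin m} {v : Fin (m * n) → Fin n}
    (h : ¬ Function.Injective fun r => (w r, v r)) : wordDet w v = 0 := by
  simp only [Function.Injective, not_forall, Prod.mk.injEq] at h
  obtain ⟨r, s, ⟨hw, hv⟩, hne⟩ := h
  refine Matrix.det_zero_of_row_eq hne ?_
  ext c
  simp [amalgam, wordMatrix_apply, hw, hv]

theorem wordDet_rowWord_colWord (γ : RectTableau m n (m * n)) :
    wordDet γ.rowWord γ.colWord = γ.sign := by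
  have h : colDetProd (wordMatrix ℤ γ.rowWord) γ = 1 := by
    refine Finset.prod_eq_one fun j _ => ?_
    have : (wordMatrix ℤ γ.rowWord).submatrix (fun i => γ (i, j)) id = 1 := by
      ext x y
      simp [wordMatrix_apply, rowWord, Matrix.one_apply]
    rw [this, Matrix.det_one]
  rw [colDetProd_eq_sign_mul_left, Int.cast_id] at h
  rw [← mul_one γ.sign, ← h, ← mul_assoc, γ.sign_mul_self, one_mul, wordDet]

theorem wordDet_comp_perm (σ : Equiv.Perm (Fin (m * n))) (w : Fin (m * n) → Fin m)
    (v : Fin (m * n) → Fin n) :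
    wordDet (w ∘ σ) (v ∘ σ) = Equiv.Perm.sign σ * wordDet w v :=
  Matrix.det_permute σ (amalgam (wordMatrix ℤ w) (wordMatrix ℤ v))

theorem fayersNumber_eq_wordDet (α : RectTableau m n (m * n)) (β : RectTableau n m (m * n)) :
    fayersNumber α β = wordDet β.colWord α.colWord := by
  unfold fayersNumber
  split_ifs with h
  · refine (wordDet_eq_zero fun hinj => ?_).symm
    obtain ⟨x, y, hne, ⟨j, hxj, hyj⟩, k, hxk, hyk⟩ := h
    rw [mem_col] at hxj hyj hxk hyk
    exact hne (hinj (Prod.ext (hxk.trans hyk.symm) (hxj.trans hyj.symm)))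
  · obtain ⟨hα, hβ⟩ := (existsUnique_of_not_hasCommonPair h).choose_spec.1
    set γ := (existsUnique_of_not_hasCommonPair h).choose
    rw [← wordDet_rowWord_colWord γ]
    congr 1
    · ext1 x
      exact (mem_col γ.conj _ x).1 ((hβ _).symm ▸ (mem_col β _ x).2 rfl)
    · ext1 x
      exact (mem_col γ _ x).1 ((hα _).symm ▸ (mem_col α _ x).2 rfl)

end

/-! ### Triangularity of the Fayers matrix -/

/-- The weight `∑ r, w r * r` of a word. It strictly orders the words that occur in the
triangularity and straightening arguments, and so stands in for the dominance order. -/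
def wordWeight {m N : ℕ} (w : Fin N → Fin m) : ℕ := ∑ r, (w r : ℕ) * r

theorem RectTableau.wordWeight_rowWord {m n N : ℕ} (γ : RectTableau m n N) :
    wordWeight γ.rowWord = ∑ j, ∑ i : Fin m, (i : ℕ) * γ (i, j) := by
  rw [wordWeight, ← Equiv.sum_comp γ, Fintype.sum_prod_type_right]
  simp [rowWord]

/-- A tableau with increasing rows is determined by its row word. -/
theorem RectTableau.eq_of_rowWord_eq {m n N : ℕ} {γ δ : RectTableau m n N}
    (hγ : ∀ i, StrictMono fun j => γ (i, j)) (hδ : ∀ i, StrictMono fun j => δ (i, j))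
    (h : γ.rowWord = δ.rowWord) : γ = δ := by
  have key : ∀ γ : RectTableau m n N, ∀ i,
      Set.range (fun j => γ (i, j)) = {x | γ.rowWord x = i} := by
    intro γ i
    ext x
    constructor
    · rintro ⟨j, rfl⟩
      simp [rowWord]
    · rintro rfl
      exact ⟨(γ.symm x).2, by simp [rowWord]⟩
  ext1 ⟨i, j⟩
  exact congrFun (((hγ i).range_inj (hδ i)).1 (by rw [key, key, h])) j

section

variable {m n : ℕ} {α δ : RectTableau m n (m * n)}

/-- If `w` and `v` are the row word of a standard tableau `δ` and the column word of a standard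
tableau `α`, then a nonzero coefficient forces the weight of `δ` to be at most that of `α`: there
is a tableau with the columns of `α` and the rows of `δ`, and sorting its columns, which yields
`α`, increases the weight by the rearrangement inequality. -/
theorem wordWeight_le_of_wordDet_ne_zero (hα : α.IsStandard) (hδ : δ.IsStandard)
    (h : wordDet δ.rowWord α.colWord ≠ 0) :
    wordWeight δ.rowWord ≤ wordWeight α.rowWord ∧
      (wordWeight δ.rowWord = wordWeight α.rowWord → α = δ) := by
  obtain ⟨γ, hr, hc⟩ := exists_of_injective (not_imp_comm.1 wordDet_eq_zero h)
  have hσ : ∀ j, ∃ σ : Equiv.Perm (Fin m), ∀ i, γ (i, j) = α (σ i, j) := by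
    intro j
    have h1 : ∀ i, γ (i, j) = α ((α.symm (γ (i, j))).1, j) := by
      intro i
      have h2 : (α.symm (γ (i, j))).2 = j := by
        have := congrFun hc (γ (i, j))
        simpa [colWord] using this.symm
      exact (α.apply_symm_apply _).symm.trans (congrArg α (Prod.ext rfl h2))
    have hinj : Function.Injective fun i => (α.symm (γ (i, j))).1 := by
      intro i i' hii
      have := (h1 i).trans ((congrArg (fun k => α (k, j)) hii).trans (h1 i').symm)
      simpa using this
    exact ⟨Equiv.ofBijective _ (Finite.injective_iff_bijective.1 hinj), h1⟩
  choose σ hσ using hσ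
  have hmono : ∀ j, Monovary (fun i : Fin m => (i : ℕ)) (fun i => (α (i, j) : ℕ)) := fun j =>
    Monotone.monovary (fun _ _ h => h) (fun _ _ h => (hα.2 j).monotone h)
  have hle : ∀ j, ∑ i : Fin m, (i : ℕ) * γ (i, j) ≤ ∑ i : Fin m, (i : ℕ) * α (i, j) := by
    intro j
    simp only [hσ]
    exact (hmono j).sum_mul_comp_perm_le_sum_mul
  rw [← hr, wordWeight_rowWord, wordWeight_rowWord]
  refine ⟨Finset.sum_le_sum fun j _ => hle j, fun heq => ?_⟩
  have heq' := (Finset.sum_eq_sum_iff_of_le fun j _ => hle j).1 heq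
  have hγα : γ = α := by
    have hcol : ∀ j, StrictMono fun i => γ (i, j) := by
      intro j
      have hj := heq' j (Finset.mem_univ j)
      simp only [hσ] at hj
      have hmv := (hmono j).sum_mul_comp_perm_eq_sum_mul_iff.1 hj
      refine Monotone.strictMono_of_injective ?_ fun i i' h => by simpa using h
      intro i i' hii
      by_contra! hlt
      have hlt' : ((fun i => (α (i, j) : ℕ)) ∘ σ j) i' < ((fun i => (α (i, j) : ℕ)) ∘ σ j) i := by
        simpa [← hσ] using hlt
      have : i' ≤ i := hmv hlt'
      obtain rfl := le_antisymm hii this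
      exact lt_irrefl _ hlt
    have := eq_of_rowWord_eq (γ := γ.conj) (δ := α.conj) hcol hα.2 hc
    exact congrArg RectTableau.conj this
  subst hγα
  exact eq_of_rowWord_eq hα.1 hδ.1 hr

end

theorem twistedFayersMatrix_apply {m n : ℕ} (α : StdRectTableau m n (m * n))
    (β : StdRectTableau n m (m * n)) :
    twistedFayersMatrix m n α β =
      α.1.sign * wordDet β.1.colWord α.1.colWord * β.1.conj.sign := by
  simp [twistedFayersMatrix, fayersMatrix, fayersNumber_eq_wordDet]

theorem isUnit_det_twistedFayersMatrix (m n : ℕ) :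
    IsUnit ((twistedFayersMatrix m n).submatrix id
      (StdRectTableau.conjEquiv m n (m * n))).det := by
  set M := (twistedFayersMatrix m n).submatrix id (StdRectTableau.conjEquiv m n (m * n)) with hM
  have hMapp : ∀ α δ, M α δ = α.1.sign * wordDet δ.1.rowWord α.1.colWord * δ.1.sign :=
    fun α δ => twistedFayersMatrix_apply α _
  have hne : ∀ α δ, M α δ ≠ 0 → wordDet δ.1.rowWord α.1.colWord ≠ 0 := by
    intro α δ h h0
    simp [hMapp, h0] at h
  let b : StdRectTableau m n (m * n) → ℕᵒᵈ := fun α => OrderDual.toDual (wordWeight α.1.rowWord)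
  have htri : M.BlockTriangular b := by
    intro α δ hlt
    by_contra h
    exact absurd (wordWeight_le_of_wordDet_ne_zero α.2 δ.2 (hne _ _ h)).1 (not_le.2 hlt)
  classical
  rw [htri.det]
  refine Finset.prod_induction _ IsUnit (fun _ _ => IsUnit.mul) isUnit_one fun k _ => ?_
  have hdiag : M.toSquareBlock b k = Matrix.diagonal fun α => α.1.1.sign := by
    ext α δ
    rw [Matrix.toSquareBlock_def, Matrix.of_apply]
    by_cases h : α = δ
    · subst h
      rw [Matrix.diagonal_apply_eq, hMapp, wordDet_rowWord_colWord, sign_mul_self, one_mul]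
    · rw [Matrix.diagonal_apply_ne _ h]
      by_contra h0
      refine h (Subtype.ext (Subtype.ext ?_))
      exact (wordWeight_le_of_wordDet_ne_zero α.1.2 δ.1.2 (hne _ _ h0)).2
        (congrArg OrderDual.ofDual (δ.2.trans α.2.symm))
  rw [hdiag, Matrix.det_diagonal]
  exact Finset.prod_induction _ IsUnit (fun _ _ => IsUnit.mul) isUnit_one
    fun α _ => α.1.1.isUnit_sign

theorem fayersPhi_inverse (m n : ℕ) :
    twistedFayersMatrix m n * (fayersPhi m n)ᵀ = 1 ∧
      (fayersPhi m n)ᵀ * twistedFayersMatrix m n = 1 := by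
  have h := isUnit_det_twistedFayersMatrix m n
  set e := StdRectTableau.conjEquiv m n (m * n)
  set M := (twistedFayersMatrix m n).submatrix id e
  have h1 : twistedFayersMatrix m n = M.submatrix id e.symm := by
    ext; simp [M]
  have h2 : (fayersPhi m n)ᵀ = M⁻¹.submatrix e.symm id := rfl
  rw [h1, h2]
  constructor
  · rw [Matrix.submatrix_mul_equiv, Matrix.mul_nonsing_inv _ h, Matrix.submatrix_id_id]
  · rw [← Matrix.submatrix_mul _ _ _ _ _ Function.bijective_id, Matrix.nonsing_inv_mul _ h,
      Matrix.submatrix_one_equiv]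

/-! ### Straightening -/

section

variable {m n N : ℕ}

/-- A Garnir relation: alternating `w` over the permutations of a set of more than `n` numbers
gives zero. By the pigeonhole principle `v` takes the same value at two elements of the set, and the
terms cancel in pairs under the transposition of these. -/
theorem sum_wordDet_comp_perm_eq_zero (w : Fin (m * n) → Fin m) (v : Fin (m * n) → Fin n)
    {S : Finset (Fin (m * n))} (hS : n < S.card) :
    ∑ σ : Equiv.Perm (Fin (m * n)) with ∀ r ∉ S, σ r = r, wordDet (w ∘ σ) v = 0 := by
  obtain ⟨s, hs, t, ht, hne, hv⟩ := Finset.exists_ne_map_eq_of_card_lt_of_maps_to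
    (t := Finset.univ) (by simpa using hS) (f := v) (fun _ _ => Finset.mem_coe.2 (Finset.mem_univ _))
  have hvs : v ∘ Equiv.swap s t = v := by
    ext1 r
    rcases eq_or_ne r s with rfl | hrs
    · simp [hv]
    rcases eq_or_ne r t with rfl | hrt
    · simp [hv]
    simp [Equiv.swap_apply_of_ne_of_ne hrs hrt]
  refine Finset.sum_involution (fun σ _ => σ * Equiv.swap s t) (fun σ _ => ?_) (fun σ _ _ => ?_)
    (fun σ hσ => ?_) (fun σ _ => ?_)
  · have := wordDet_comp_perm (Equiv.swap s t) (w ∘ σ) v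
    rw [hvs, Equiv.Perm.sign_swap hne] at this
    rw [Equiv.Perm.coe_mul, ← Function.comp_assoc, this]
    simp
  · simpa using hne
  · simp only [Finset.mem_filter, Finset.mem_univ, true_and] at hσ ⊢
    intro r hr
    rw [Equiv.Perm.mul_apply, Equiv.swap_apply_of_ne_of_ne (fun h : r = s => hr (h ▸ hs))
      (fun h : r = t => hr (h ▸ ht)), hσ r hr]
  · simp [mul_assoc]

/-- The rows of a tableau can be sorted. -/
theorem RectTableau.exists_rowWord_eq_strictMono (γ : RectTableau m n N) :
    ∃ δ : RectTableau m n N, δ.rowWord = γ.rowWord ∧ ∀ i, StrictMono fun j => δ (i, j) := by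
  let f : Fin m × Fin n → Fin N := fun b => (γ.conj.col b.1).orderEmbOfFin (γ.conj.card_col b.1) b.2
  have hf : ∀ b, γ.rowWord (f b) = b.1 := fun b =>
    (mem_col γ.conj b.1 (f b)).1 (Finset.orderEmbOfFin_mem _ _ _)
  have hinj : Function.Injective f := by
    rintro ⟨i, j⟩ ⟨i', j'⟩ h
    obtain rfl : i = i' := (hf (i, j)).symm.trans ((congrArg γ.rowWord h).trans (hf (i', j')))
    simpa [f] using h
  have hbij := (Fintype.bijective_iff_injective_and_card f).2 ⟨hinj, Fintype.card_congr γ⟩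
  refine ⟨Equiv.ofBijective f hbij, ?_, fun i =>
    ((γ.conj.col i).orderEmbOfFin (γ.conj.card_col i)).strictMono⟩
  ext1 r
  obtain ⟨b, rfl⟩ := hbij.2 r
  rw [hf, rowWord]
  congr 1
  exact (Equiv.ofBijective f hbij).symm_apply_apply b

/-- A rearrangement of a word that is pointwise comparable with it is equal to it. -/
theorem comp_perm_eq_of_le {w : Fin N → Fin m} {σ : Equiv.Perm (Fin N)}
    (h : (∀ r, w r ≤ w (σ r)) ∨ ∀ r, w (σ r) ≤ w r) : w ∘ σ = w := by
  have hsum : ∑ r, (w (σ r) : ℕ) = ∑ r, (w r : ℕ) := Equiv.sum_comp σ fun r => (w r : ℕ)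
  ext r
  rcases h with h | h
  · exact ((Finset.sum_eq_sum_iff_of_le fun r _ => Fin.le_def.1 (h r)).1 hsum.symm r
      (Finset.mem_univ r)).symm
  · exact (Finset.sum_eq_sum_iff_of_le fun r _ => Fin.le_def.1 (h r)).1 hsum r (Finset.mem_univ r)

/-- Let `w` take the value `i` on a set `X` of large numbers and a value `i' > i` on a set `Y` of
small numbers. A permutation of `X ∪ Y` that changes `w` increases its weight. -/
theorem wordWeight_lt_comp_perm {w : Fin N → Fin m} {X Y : Finset (Fin N)} {i i' : Fin m}
    (hi : i < i') (hX : ∀ x ∈ X, w x = i) (hY : ∀ y ∈ Y, w y = i') (hYX : ∀ y ∈ Y, ∀ x ∈ X, y < x)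
    {σ : Equiv.Perm (Fin N)} (hσ : ∀ r ∉ X ∪ Y, σ r = r) (hne : w ∘ σ ≠ w) :
    wordWeight w < wordWeight (w ∘ σ) := by
  have hmaps : ∀ r ∈ X ∪ Y, w (σ r) = i ∨ w (σ r) = i' := by
    intro r hr
    have : σ r ∈ X ∪ Y := by
      by_contra h
      exact h ((σ.injective (hσ _ h)).symm ▸ hr)
    rcases Finset.mem_union.1 this with h | h
    · exact Or.inl (hX _ h)
    · exact Or.inr (hY _ h)
  have hanti : AntivaryOn (fun r => (w r : ℕ)) (fun r : Fin N => (r : ℕ))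
      (X ∪ Y : Finset (Fin N)) := by
    intro r hr s hs hrs
    rcases Finset.mem_union.1 hr with hr | hr <;> rcases Finset.mem_union.1 hs with hs | hs
    · simp [hX r hr, hX s hs]
    · exact absurd hrs (hYX s hs r hr).not_gt
    · simpa [hX s hs, hY r hr] using hi.le
    · simp [hY r hr, hY s hs]
  have hlt := (hanti.sum_mul_lt_sum_comp_perm_mul_iff (σ := σ)
    fun r hr => by_contra fun h => hr (hσ r h)).2 ?_
  · rw [wordWeight, wordWeight, ← Finset.sum_add_sum_compl (X ∪ Y),
      ← Finset.sum_add_sum_compl (X ∪ Y) fun r => ((w ∘ σ) r : ℕ) * r]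
    refine add_lt_add_of_lt_of_le hlt (Finset.sum_le_sum fun r hr => ?_)
    rw [Function.comp_apply, hσ r (Finset.mem_compl.1 hr)]
  · intro hσanti
    refine hne (comp_perm_eq_of_le ?_)
    by_cases h : ∃ y ∈ Y, w (σ y) = i
    · obtain ⟨y, hy, hyi⟩ := h
      refine Or.inr fun r => ?_
      by_cases hr : r ∈ X ∪ Y
      · rcases Finset.mem_union.1 hr with hrX | hrY
        · have : w (σ r) ≤ w (σ y) :=
            hσanti (Finset.mem_union_right _ hy) (Finset.mem_union_left _ hrX) (hYX y hy r hrX)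
          rwa [hX r hrX, ← hyi]
        · rcases hmaps r hr with h | h <;> simp [h, hY r hrY, hi.le]
      · rw [hσ r hr]
    · push Not at h
      refine Or.inl fun r => ?_
      by_cases hr : r ∈ X ∪ Y
      · rcases Finset.mem_union.1 hr with hrX | hrY
        · rcases hmaps r hr with h | h <;> simp [h, hX r hrX, hi.le]
        · rw [hY r hrY, (hmaps r hr).resolve_left (h r hrY)]
      · rw [hσ r hr]

/-- Straightening over `ℚ`: the coefficients of an arbitrary tableau are linear combinations of
those of the standard tableaux, with the same scalars for all words `v`. -/
theorem wordDet_rowWord_mem_span (γ : RectTableau m n (m * n)) :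
    (fun v => (wordDet γ.rowWord v : ℚ)) ∈ Submodule.span ℚ
      (Set.range fun (δ : StdRectTableau m n (m * n)) v => (wordDet δ.1.rowWord v : ℚ)) := by
  set V := Submodule.span ℚ
      (Set.range fun (δ : StdRectTableau m n (m * n)) v => (wordDet δ.1.rowWord v : ℚ)) with hV
  by_contra hγ
  -- A counterexample of greatest weight, with its rows sorted.
  obtain ⟨γ, hγ, hmax⟩ := Set.exists_max_image
    {γ : RectTableau m n (m * n) | (fun v => (wordDet γ.rowWord v : ℚ)) ∉ V}
    (fun γ => wordWeight γ.rowWord) (Set.toFinite _) ⟨γ, hγ⟩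
  obtain ⟨δ, hw, hrow⟩ := γ.exists_rowWord_eq_strictMono
  simp only [Set.mem_ofPred_eq, ← hw] at hγ hmax
  have hcol : ¬ ∀ j, StrictMono fun i => δ (i, j) := fun hcol =>
    hγ (Submodule.subset_span ⟨⟨δ, hrow, hcol⟩, rfl⟩)
  simp only [StrictMono, not_forall, not_lt] at hcol
  obtain ⟨j, i, i', hi, hle⟩ := hcol
  have hlt : δ (i', j) < δ (i, j) := lt_of_le_of_ne hle (by simp [hi.ne'])
  let X := (Finset.Ici j).image fun k => δ (i, k)
  let Y := (Finset.Iic j).image fun k => δ (i', k)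
  have hX : ∀ x ∈ X, δ.rowWord x = i := by simp [X, rowWord]
  have hY : ∀ y ∈ Y, δ.rowWord y = i' := by simp [Y, rowWord]
  have hYX : ∀ y ∈ Y, ∀ x ∈ X, y < x := by
    simp only [X, Y, Finset.mem_image, Finset.mem_Iic, Finset.mem_Ici]
    rintro _ ⟨k, hk, rfl⟩ _ ⟨l, hl, rfl⟩
    exact ((hrow i').monotone hk).trans_lt (hlt.trans_le ((hrow i).monotone hl))
  have hcard : n < (X ∪ Y).card := by
    rw [Finset.card_union_of_disjoint, Finset.card_image_of_injective _ (hrow i).injective,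
      Finset.card_image_of_injective _ (hrow i').injective, Fin.card_Ici, Fin.card_Iic]
    · omega
    · exact Finset.disjoint_left.2 fun x hx hy => (hYX x hy x hx).false
  classical
  have hrel : ∑ σ : Equiv.Perm (Fin (m * n)) with ∀ r ∉ X ∪ Y, σ r = r,
      (fun v => (wordDet (δ.rowWord ∘ σ) v : ℚ)) = 0 := by
    ext v
    rw [Finset.sum_apply, Pi.zero_apply]
    exact_mod_cast sum_wordDet_comp_perm_eq_zero δ.rowWord v hcard
  -- The terms that fix the word contribute a positive multiple of the counterexample; the others
  -- have greater weight.
  rw [← Finset.sum_filter_add_sum_filter_not _ fun σ : Equiv.Perm (Fin (m * n)) =>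
    δ.rowWord ∘ σ = δ.rowWord] at hrel
  rw [Finset.sum_congr rfl (g := fun _ v => (wordDet δ.rowWord v : ℚ)) fun σ hσ => by
    rw [(Finset.mem_filter.1 hσ).2], Finset.sum_const] at hrel
  have hmem := V.neg_mem (V.sum_mem (t := Finset.filter (fun σ : Equiv.Perm (Fin (m * n)) =>
    ¬ δ.rowWord ∘ σ = δ.rowWord) (Finset.univ.filter fun σ => ∀ r ∉ X ∪ Y, σ r = r))
    (f := fun σ v => (wordDet (δ.rowWord ∘ σ) v : ℚ)) fun σ hσ => by
      simp only [Finset.mem_filter, Finset.mem_univ, true_and] at hσ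
      by_contra h
      exact (wordWeight_lt_comp_perm hi hX hY hYX hσ.1 hσ.2).not_ge
        (hmax (δ.trans σ.symm : RectTableau m n (m * n)) h))
  rw [← eq_neg_of_add_eq_zero_left hrel, ← Nat.cast_smul_eq_nsmul ℚ] at hmem
  refine hγ ((V.smul_mem_iff ?_).1 hmem)
  rw [Nat.cast_ne_zero]
  exact Finset.card_ne_zero_of_mem (a := 1) (by simp)

end

/-! ### The expansion of the determinant -/

section

variable {m n : ℕ}

/-- The expansion for word matrices: a matrix identity `D = D_S F⁻¹ D_S'`, in which the rows of
`D = (wordDet w v)` are spanned by those of the submatrix `D_S'` of standard tableaux. -/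
theorem wordDet_eq_sum (w : Fin (m * n) → Fin m) (v : Fin (m * n) → Fin n) :
    wordDet w v = ∑ α : StdRectTableau m n (m * n), ∑ β : StdRectTableau n m (m * n),
      fayersPhi m n α β * colDetProd (wordMatrix ℤ w) α.1 * colDetProd (wordMatrix ℤ v) β.1 := by
  obtain ⟨T, hT⟩ : ∃ T : StdRectTableau n m (m * n) → ℚ,
      ∀ v, (wordDet w v : ℚ) = ∑ β, T β * wordDet β.1.colWord v := by
    by_cases hw : ∃ γ : RectTableau m n (m * n), γ.rowWord = w
    · obtain ⟨γ, rfl⟩ := hw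
      obtain ⟨c, hc⟩ := (Submodule.mem_span_range_iff_exists_fun ℚ).1 (wordDet_rowWord_mem_span γ)
      refine ⟨c ∘ (StdRectTableau.conjEquiv m n (m * n)).symm, fun v => ?_⟩
      rw [← (StdRectTableau.conjEquiv m n (m * n)).sum_comp, ← congrFun hc v, Finset.sum_apply]
      simp only [Pi.smul_apply, smul_eq_mul, Function.comp_apply, Equiv.symm_apply_apply]
      rfl
    · refine ⟨0, fun v => ?_⟩
      rw [wordDet_eq_zero fun hinj => hw ((exists_of_injective hinj).imp fun _ h => h.1)]
      simp
  have hx : ∀ α : StdRectTableau m n (m * n),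
      colDetProd (wordMatrix ℤ w) α.1 = α.1.sign * wordDet w α.1.colWord := by
    intro α
    rw [wordDet, colDetProd_eq_sign_mul_left, Int.cast_id]
  have hy : ∀ β : StdRectTableau n m (m * n),
      colDetProd (wordMatrix ℤ v) β.1 = β.1.conj.sign * wordDet β.1.colWord v := by
    intro β
    rw [wordDet, colDetProd_eq_sign_mul_right, Int.cast_id]
  have hsq : ∀ β : StdRectTableau n m (m * n), (β.1.conj.sign : ℚ) * β.1.conj.sign = 1 := by
    intro β
    exact_mod_cast β.1.conj.sign_mul_self
  let G : Matrix _ _ ℚ := (twistedFayersMatrix m n).map (Int.castRingHom ℚ)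
  let P : Matrix _ _ ℚ := ((fayersPhi m n)ᵀ).map (Int.castRingHom ℚ)
  have hPG : P * G = 1 := by
    rw [← Matrix.map_mul, (fayersPhi_inverse m n).2, Matrix.map_one _ (map_zero _) (map_one _)]
  let u : StdRectTableau n m (m * n) → ℚ := fun β => β.1.conj.sign * T β
  have hGu : (fun α : StdRectTableau m n (m * n) =>
      ((colDetProd (wordMatrix ℤ w) α.1 : ℤ) : ℚ)) = G *ᵥ u := by
    ext α
    rw [hx, Int.cast_mul, hT, Finset.mul_sum]
    refine Finset.sum_congr rfl fun β _ => ?_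
    simp only [G, u, Matrix.map_apply, twistedFayersMatrix_apply, eq_intCast, Int.cast_mul]
    linear_combination (-(α.1.sign : ℚ) * T β * wordDet β.1.colWord α.1.colWord) * hsq β
  have hu : ∀ β, ∑ α : StdRectTableau m n (m * n),
      (fayersPhi m n α β : ℚ) * (colDetProd (wordMatrix ℤ w) α.1 : ℤ) = u β := by
    intro β
    have : (P *ᵥ (G *ᵥ u)) β = u β := by rw [Matrix.mulVec_mulVec, hPG, Matrix.one_mulVec]
    rw [← this, ← hGu]
    rfl
  rw [← Int.cast_inj (α := ℚ), Finset.sum_comm]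
  push_cast
  simp only [← Finset.sum_mul, hu]
  rw [hT]
  refine Finset.sum_congr rfl fun β _ => ?_
  rw [hy, Int.cast_mul]
  linear_combination (-T β * wordDet β.1.colWord v) * hsq β

variable {R : Type*} [CommRing R]

/-- A function on `N × k` matrices is multilinear in the rows if its value at `A` is obtained by
expanding every row of `A` in the standard basis. -/
def IsRowMultilinear {N k : ℕ} (f : Matrix (Fin N) (Fin k) R → R) : Prop :=
  ∀ A, f A = ∑ w : Fin N → Fin k, (∏ r, A r (w r)) * f (wordMatrix R w)

namespace IsRowMultilinear

variable {N k : ℕ} {f g : Matrix (Fin N) (Fin k) R → R}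

theorem of_multilinearMap (F : MultilinearMap R (fun _ : Fin N => Fin k → R) R)
    (h : ∀ A, f A = F fun r => A r) : IsRowMultilinear f := by
  intro A
  have hA : (fun r => A r) = fun r => ∑ c, A r c • wordMatrix R (fun _ : Fin N => c) r := by
    ext r c
    simp [wordMatrix_apply]
  rw [h, hA, F.map_sum]
  refine Finset.sum_congr rfl fun w _ => ?_
  rw [F.map_smul_univ (fun r => A r (w r)) fun r => wordMatrix R (fun _ => w r) r, h, smul_eq_mul]
  rfl

theorem ext (hf : IsRowMultilinear f) (hg : IsRowMultilinear g)
    (h : ∀ w, f (wordMatrix R w) = g (wordMatrix R w)) (A : Matrix (Fin N) (Fin k) R) :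
    f A = g A := by
  rw [hf, hg]
  simp only [h]

theorem const_mul (hf : IsRowMultilinear f) (c : R) : IsRowMultilinear fun A => c * f A := by
  intro A
  dsimp only
  rw [hf, Finset.mul_sum]
  exact Finset.sum_congr rfl fun w _ => mul_left_comm _ _ _

theorem mul_const (hf : IsRowMultilinear f) (c : R) : IsRowMultilinear fun A => f A * c := by
  simpa only [mul_comm] using hf.const_mul c

theorem sum {ι : Type*} [Fintype ι] {f : ι → Matrix (Fin N) (Fin k) R → R}
    (hf : ∀ i, IsRowMultilinear (f i)) : IsRowMultilinear fun A => ∑ i, f i A := by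
  intro A
  dsimp only
  simp only [Finset.mul_sum]
  rw [Finset.sum_comm]
  exact Finset.sum_congr rfl fun i _ => hf i A

theorem det_amalgam_left (B : Matrix (Fin (m * n)) (Fin n) R) :
    IsRowMultilinear fun A : Matrix (Fin (m * n)) (Fin m) R => (amalgam A B).det := by
  refine of_multilinearMap ((Matrix.detRowAlternating (n := Fin (m * n)) (R := R)).toMultilinearMap
    |>.compLinearMap fun r => LinearMap.pi fun c =>
      B r ((one m n).symm c).2 • LinearMap.proj ((one m n).symm c).1) fun A => ?_
  change _ = Matrix.det _
  congr 1
  ext r c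
  exact mul_comm _ _

theorem det_amalgam_right (A : Matrix (Fin (m * n)) (Fin m) R) :
    IsRowMultilinear fun B : Matrix (Fin (m * n)) (Fin n) R => (amalgam A B).det :=
  of_multilinearMap ((Matrix.detRowAlternating (n := Fin (m * n)) (R := R)).toMultilinearMap
    |>.compLinearMap fun r => LinearMap.pi fun c =>
      A r ((one m n).symm c).1 • LinearMap.proj ((one m n).symm c).2) fun _ => rfl

theorem colDetProd_left (γ : RectTableau m n (m * n)) :
    IsRowMultilinear fun A : Matrix (Fin (m * n)) (Fin m) R => colDetProd A γ := by
  simp only [colDetProd_eq_sign_mul_left]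
  exact (det_amalgam_left _).const_mul _

theorem colDetProd_right (γ : RectTableau n m (m * n)) :
    IsRowMultilinear fun B : Matrix (Fin (m * n)) (Fin n) R => colDetProd B γ := by
  simp only [colDetProd_eq_sign_mul_right]
  exact (det_amalgam_right _).const_mul _

end IsRowMultilinear

theorem colDetProd_wordMatrix {N : ℕ} (w : Fin N → Fin m) (γ : RectTableau m n N) :
    colDetProd (wordMatrix R w) γ = (colDetProd (wordMatrix ℤ w) γ : ℤ) := by
  simp only [colDetProd, Int.cast_prod]
  refine Finset.prod_congr rfl fun j _ => ?_
  rw [← eq_intCast (Int.castRingHom R), RingHom.map_det]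
  congr 1
  ext x y
  simp [wordMatrix_apply]

theorem det_amalgam_eq_sum_colDetProd (A : Matrix (Fin (m * n)) (Fin m) R)
    (B : Matrix (Fin (m * n)) (Fin n) R) :
    (amalgam A B).det = ∑ α : StdRectTableau m n (m * n), ∑ β : StdRectTableau n m (m * n),
      (fayersPhi m n α β : R) * colDetProd A α.1 * colDetProd B β.1 := by
  have hA : IsRowMultilinear fun A : Matrix (Fin (m * n)) (Fin m) R =>
      ∑ α : StdRectTableau m n (m * n), ∑ β : StdRectTableau n m (m * n),
        (fayersPhi m n α β : R) * colDetProd A α.1 * colDetProd B β.1 :=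
    .sum fun α => .sum fun β =>
      ((IsRowMultilinear.colDetProd_left α.1).const_mul (fayersPhi m n α β : R)).mul_const _
  refine (IsRowMultilinear.det_amalgam_left B).ext hA (fun w => ?_) A
  have hB : IsRowMultilinear fun B : Matrix (Fin (m * n)) (Fin n) R =>
      ∑ α : StdRectTableau m n (m * n), ∑ β : StdRectTableau n m (m * n),
        (fayersPhi m n α β : R) * colDetProd (wordMatrix R w) α.1 * colDetProd B β.1 :=
    .sum fun α => .sum fun β => (IsRowMultilinear.colDetProd_right β.1).const_mul _
  refine (IsRowMultilinear.det_amalgam_right _).ext hB (fun v => ?_) B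
  rw [det_amalgam_wordMatrix, wordDet_eq_sum]
  simp [colDetProd_wordMatrix (R := R)]

end

theorem theorem3 {R : Type*} [CommRing R] (m n : ℕ) (hm : 1 ≤ m) (hn : 1 ≤ n)
    (A : Matrix (Fin (m * n)) (Fin m) R) (B : Matrix (Fin (m * n)) (Fin n) R) :
    twistedFayersMatrix m n * (fayersPhi m n)ᵀ = 1 ∧
    (fayersPhi m n)ᵀ * twistedFayersMatrix m n = 1 ∧
    (amalgam A B).det =
      ∑ α : StdRectTableau m n (m * n), ∑ β : StdRectTableau n m (m * n),
        (fayersPhi m n α β : R) * minorProd A α.1 * minorProd B β.1 := by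
  refine ⟨(fayersPhi_inverse m n).1, (fayersPhi_inverse m n).2, ?_⟩
  rw [det_amalgam_eq_sum_colDetProd]
  refine Finset.sum_congr rfl fun α _ => Finset.sum_congr rfl fun β _ => ?_
  rw [minorProd_eq_colDetProd A α.2, minorProd_eq_colDetProd B β.2]
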